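/- All rings are commutative. A Gorenstein local ring is a noetherian local ring of finite injective dimension as a module over itself. For a Gorenstein local ring $R$ with maximal ideal $\mathfrak m$, a maximal Cohen--Macaulay module is a finitely generated $R$-module $M$ with $\operatorname{Ext}^i_R(M,R)=0$ for all $i>0$. Let $\underline{\mathrm{CM}}(R)$ be the stable category: its objects are the maximal Cohen--Macaulay $R$-modules, and its morphisms are the $R$-homomorphisms modulo those that factor through a free module. It is a triangulated category in the usual way (the suspension is the cosyzygy, and the distinguished triangles come from short exact sequences). Let $\underline{\mathrm{CM}}_0(R)$ be its full subcategory of the modules $M$ that are locally free on the punctured spectrum, that is, $M_{\mathfrak p}$ is a free $R_{\mathfrak p}$-module for all prime ideals $\mathfrak p\neq\mathfrak m$; it is a triangulated subcategory, with Verdier quotient $\underline{\mathrm{CM}}(R)/\underline{\mathrm{CM}}_0(R)$. **Proposition.** Let $R$ and $S$ be Gorenstein local rings, and let $F:\underline{\mathrm{CM}}(R)\to\underline{\mathrm{CM}}(S)$ be a triangle equivalence (not assumed to be linear over any ring). Then: 1. For $T\in\{R,S\}$ and every $M\in\underline{\mathrm{CM}}(T)$, the following are equivalent: $M\in\underline{\mathrm{CM}}_0(T)$;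 the stable endomorphism ring $\underline{\operatorname{End}}_T(M)$ is left artinian; $\underline{\operatorname{End}}_T(M)$ is right artinian. 2. For every $M\in\underline{\mathrm{CM}}(R)$ one has $M\in\underline{\mathrm{CM}}_0(R)$ if and only if $F(M)\in\underline{\mathrm{CM}}_0(S)$. 3. $F$ restricts to a triangle equivalence $\underline{\mathrm{CM}}_0(R)\simeq\underline{\mathrm{CM}}_0(S)$: there is a triangle equivalence $F_0$ between these categories whose composite with the inclusion into $\underline{\mathrm{CM}}(S)$ is isomorphic, by an isomorphism compatible with the suspensions, to the restriction of $F$ to $\underline{\mathrm{CM}}_0(R)$. 4. $F$ induces a triangle equivalence $\underline{\mathrm{CM}}(R)/\underline{\mathrm{CM}}_0(R)\simeq\underline{\mathrm{CM}}(S)/\underline{\mathrm{CM}}_0(S)$: there is a triangle equivalence $G$ between these Verdier quotients such that $G\circ Q_R\cong Q_S\circ F$, by an isomorphism compatible with the suspensions, where $Q_R$ and $Q_S$ are the quotient functors. -/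

import Mathlib

open CategoryTheory CategoryTheory.Limits ZeroObject

universe u v

/-- A commutative ring is a Gorenstein local ring if it is local and noetherian and has finite
injective dimension as a module over itself. -/
class IsGorensteinLocalRing (R : Type u) [CommRing R] : Prop
    extends IsLocalRing R, IsNoetherianRing R where
  finite_injectiveDimension : ∃ n : ℕ, HasInjectiveDimensionLE (ModuleCat.of R R) n

namespace StableMCM

section Ext

variable {R : Type u} [CommRing R]

/-- The maximal Cohen-Macaulay modules over a Gorenstein ring: the finitely generated modules `M`
with `Ext^i(M, R) = 0` for all `i > 0`. -/
def isMCM (R : Type u) [CommRing R] : ObjectProperty (ModuleCat.{u} R) := fun M =>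
  Module.Finite R M ∧ ∀ i : ℕ, 0 < i → Subsingleton (Abelian.Ext M (ModuleCat.of R R) i)

/-- Vanishing of one extension module with values in the ring. -/
abbrev ExtZero (M : Type u) [AddCommGroup M] [Module R M] (i : ℕ) : Prop :=
  Subsingleton (Abelian.Ext (ModuleCat.of R M) (ModuleCat.of R R) i)

variable {A P B : Type u} [AddCommGroup A] [Module R A] [AddCommGroup P] [Module R P]
  [AddCommGroup B] [Module R B]

/-- Short exact sequences of modules. -/
structure SES (f : A →ₗ[R] P) (g : P →ₗ[R] B) : Prop where
  inj : Function.Injective f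
  exact : Function.Exact f g
  surj : Function.Surjective g

namespace SES

variable {f : A →ₗ[R] P} {g : P →ₗ[R] B}

lemma zero (h : SES f g) : ModuleCat.ofHom f ≫ ModuleCat.ofHom g = 0 := by
  ext x
  exact h.exact.apply_apply_eq_zero x

lemma shortExact (h : SES f g) :
    (ShortComplex.mk (ModuleCat.ofHom f) (ModuleCat.ofHom g) h.zero).ShortExact :=
  ModuleCat.shortComplex_shortExact _ h.exact h.inj h.surj

lemma ext_left (h : SES f g) [Module.Free R P] {i : ℕ} (hB : ExtZero (R := R) B (i + 2)) :
    ExtZero (R := R) A (i + 1) := by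
  have hP : Projective (ModuleCat.of R P) := inferInstance
  refine ⟨fun x y => ?_⟩
  rw [← sub_eq_zero]
  obtain ⟨z, hz⟩ := Abelian.Ext.contravariant_sequence_exact₁ h.shortExact _ (x - y)
    (n₁ := i + 2) (by omega) (hB.elim _ _)
  rw [← hz, Abelian.Ext.eq_zero_of_projective z, Abelian.Ext.comp_zero]

lemma ext_right (h : SES f g) [Module.Free R P] {i : ℕ} (hA : ExtZero (R := R) A (i + 1)) :
    ExtZero (R := R) B (i + 2) := by
  have hP : Projective (ModuleCat.of R P) := inferInstance
  refine ⟨fun x y => ?_⟩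
  rw [← sub_eq_zero]
  obtain ⟨z, hz⟩ := Abelian.Ext.contravariant_sequence_exact₃ h.shortExact _ (x - y)
    (Abelian.Ext.eq_zero_of_projective _) (n₀ := i + 1) (by omega)
  rw [← hz, hA.elim z 0, Abelian.Ext.comp_zero]

lemma ext_one (h : SES f g) [Module.Free R P]
    (hf : ∀ φ : A →ₗ[R] R, ∃ ψ : P →ₗ[R] R, ψ ∘ₗ f = φ) : ExtZero (R := R) B 1 := by
  have hP : Projective (ModuleCat.of R P) := inferInstance
  refine ⟨fun x y => ?_⟩
  rw [← sub_eq_zero]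
  obtain ⟨z, hz⟩ := Abelian.Ext.contravariant_sequence_exact₃ h.shortExact _ (x - y)
    (Abelian.Ext.eq_zero_of_projective _) (n₀ := 0) (by omega)
  obtain ⟨φ, rfl⟩ := Abelian.Ext.homEquiv₀.symm.surjective z
  obtain ⟨ψ, hψ⟩ := hf φ.hom
  have : φ = ModuleCat.ofHom f ≫ ModuleCat.ofHom ψ := by
    ext1; exact hψ.symm
  rw [← hz, Abelian.Ext.homEquiv₀_symm_apply, this, ← Abelian.Ext.mk₀_comp_mk₀]
  exact h.shortExact.extClass_comp_assoc _

lemma extend_ring (h : SES f g) (hB : ExtZero (R := R) B 1) (φ : A →ₗ[R] R) :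
    ∃ ψ : P →ₗ[R] R, ψ ∘ₗ f = φ := by
  obtain ⟨z, hz⟩ := Abelian.Ext.contravariant_sequence_exact₁ h.shortExact (ModuleCat.of R R)
    (Abelian.Ext.mk₀ (ModuleCat.ofHom φ)) (n₁ := 1) (by omega) (hB.elim _ _)
  obtain ⟨ψ, rfl⟩ := Abelian.Ext.homEquiv₀.symm.surjective z
  rw [Abelian.Ext.homEquiv₀_symm_apply, Abelian.Ext.mk₀_comp_mk₀] at hz
  have := congrArg ModuleCat.Hom.hom (Abelian.Ext.homEquiv₀.symm.injective hz)
  exact ⟨ψ.hom, this⟩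

lemma extend (h : SES f g) (hB : ExtZero (R := R) B 1) {Q : Type u} [AddCommGroup Q] [Module R Q]
    [Module.Free R Q] [Module.Finite R Q] (φ : A →ₗ[R] Q) : ∃ ψ : P →ₗ[R] Q, ψ ∘ₗ f = φ := by
  let e := (Module.Free.chooseBasis R Q).equivFun
  choose ψ hψ using fun i => h.extend_ring hB (LinearMap.proj i ∘ₗ e.toLinearMap ∘ₗ φ)
  refine ⟨e.symm.toLinearMap ∘ₗ LinearMap.pi ψ, ?_⟩
  ext x
  apply e.injective
  ext i
  simpa using LinearMap.congr_fun (hψ i) x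

end SES

lemma ses_ker (g : P →ₗ[R] B) (hg : Function.Surjective g) : SES (LinearMap.ker g).subtype g :=
  ⟨Subtype.val_injective, fun x => by simp, hg⟩

lemma exists_cover (R : Type u) [CommRing R] (M : Type u) [AddCommGroup M] [Module R M]
    [Module.Finite R M] :
    ∃ (n : ℕ) (g : (Fin n → R) →ₗ[R] M), Function.Surjective g := by
  exact Module.Finite.exists_fin' R M

/-- one step of dualising -/
lemma SES.dual {f : A →ₗ[R] P} {g : P →ₗ[R] B} (h : SES f g) (hB : ExtZero (R := R) B 1) :
    SES (R := R) (g.dualMap) (f.dualMap) := by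
  refine ⟨LinearMap.dualMap_injective_of_surjective h.surj, fun φ => ⟨fun hφ => ?_, ?_⟩,
    fun φ => h.extend_ring hB φ⟩
  · refine ⟨(h.exact.linearEquivOfSurjective h.surj).symm.toLinearMap.dualMap
      ((LinearMap.range f).liftQ φ ?_), ?_⟩
    · rintro _ ⟨x, rfl⟩
      exact LinearMap.congr_fun hφ x
    · ext x
      have : (h.exact.linearEquivOfSurjective h.surj).symm (g x) = Submodule.Quotient.mk x := by
        rw [LinearEquiv.symm_apply_eq]; rfl
      simp [this]
  · rintro ⟨ψ, rfl⟩
    ext x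
    simp [h.exact.apply_apply_eq_zero]

/-- Vanishing of all the higher extension modules with values in the ring. -/
abbrev ExtVan (M : Type u) [AddCommGroup M] [Module R M] : Prop :=
  ∀ i : ℕ, ExtZero (R := R) M (i + 1)

lemma SES.van_left {f : A →ₗ[R] P} {g : P →ₗ[R] B} (h : SES f g) [Module.Free R P]
    (hB : ExtVan (R := R) B) : ExtVan (R := R) A := fun i => h.ext_left (hB (i + 1))

variable [IsGorensteinLocalRing R]

lemma exists_bound (R : Type u) [CommRing R] [IsGorensteinLocalRing R] :
    ∃ d : ℕ, ∀ (M : Type u) [AddCommGroup M] [Module R M] (i : ℕ), d ≤ i → ExtZero (R := R) M i := by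
  obtain ⟨n, hn⟩ := IsGorensteinLocalRing.finite_injectiveDimension (R := R)
  exact ⟨n + 1, fun M _ _ i hi => HasInjectiveDimensionLT.subsingleton _ (n + 1) i hi _⟩

lemma dual_van (M : Type u) [AddCommGroup M] [Module R M] [Module.Finite R M]
    (hM : ExtVan (R := R) M) : ExtVan (R := R) (Module.Dual R M) := by
  obtain ⟨d, hd⟩ := exists_bound R
  have key : ∀ k : ℕ, ∀ (M : Type u) [AddCommGroup M] [Module R M] [Module.Finite R M],
      ExtVan (R := R) M → ∀ i, d ≤ i + k → ExtZero (R := R) (Module.Dual R M) (i + 1) := by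
    intro k
    induction k with
    | zero => exact fun M _ _ _ _ i hi => hd _ _ (by omega)
    | succ k ih =>
      intro M _ _ _ hM i hi
      obtain ⟨n, g, hg⟩ := exists_cover R M
      have h := ses_ker g hg
      exact (h.dual (hM 0)).ext_left (ih _ (h.van_left hM) (i + 1) (by omega))
  exact fun i => key d M hM i (by omega)

lemma eval_surjective (M : Type u) [AddCommGroup M] [Module R M] [Module.Finite R M]
    (hM : ExtVan (R := R) M) : Function.Surjective (Module.Dual.eval R M) := by
  intro φ
  obtain ⟨n, g, hg⟩ := exists_cover R M
  have h := ses_ker g hg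
  obtain ⟨ψ, rfl⟩ := (h.dual (hM 0)).extend_ring (dual_van _ (h.van_left hM) 0) φ
  obtain ⟨p, rfl⟩ := (Module.evalEquiv R (Fin n → R)).surjective ψ
  exact ⟨g p, rfl⟩

lemma eval_injective (M : Type u) [AddCommGroup M] [Module R M] [Module.Finite R M]
    (hM : ExtVan (R := R) M) : Function.Injective (Module.Dual.eval R M) := by
  rw [injective_iff_map_eq_zero]
  intro m hm
  obtain ⟨n, g, hg⟩ := exists_cover R M
  have h := ses_ker g hg
  obtain ⟨p, rfl⟩ := hg m
  have hd := h.dual (hM 0)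
  let φ : Module.Dual R (Module.Dual R (LinearMap.ker g)) :=
    ((LinearMap.range (g.dualMap)).liftQ (Module.Dual.eval R _ p) (by
      rintro _ ⟨ξ, rfl⟩
      exact LinearMap.congr_fun hm ξ)) ∘ₗ
        (hd.exact.linearEquivOfSurjective hd.surj).symm.toLinearMap
  obtain ⟨q, hq⟩ := eval_surjective _ (h.van_left hM) φ
  have hpq : Module.Dual.eval R _ (q : Fin n → R) = Module.Dual.eval R _ p := by
    ext1 ξ
    have h1 := LinearMap.congr_fun hq ((LinearMap.ker g).subtype.dualMap ξ)
    have h2 : (hd.exact.linearEquivOfSurjective hd.surj).symm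
        ((LinearMap.ker g).subtype.dualMap ξ) = Submodule.Quotient.mk ξ := by
      rw [LinearEquiv.symm_apply_eq]; rfl
    refine h1.trans ?_
    simp [φ, h2]
  have := (Module.evalEquiv R (Fin n → R)).injective hpq
  rw [← this]
  exact q.2

lemma exists_cosyzygy (M : Type u) [AddCommGroup M] [Module R M] [Module.Finite R M]
    (hM : ExtVan (R := R) M) : ∃ (n : ℕ) (f : M →ₗ[R] (Fin n → R)), Function.Injective f ∧
      ExtVan (R := R) ((Fin n → R) ⧸ LinearMap.range f) := by
  have hfin : Module.Finite R (Module.Dual R M) := by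
    obtain ⟨n, g, hg⟩ := exists_cover R M
    exact Module.Finite.of_injective g.dualMap (LinearMap.dualMap_injective_of_surjective hg)
  obtain ⟨n, c, hc⟩ := exists_cover R (Module.Dual R M)
  let f : M →ₗ[R] (Fin n → R) := LinearMap.pi fun j => c (Pi.single j 1)
  have hcf : ∀ r m, c r m = ∑ j, r j * f m j := by
    intro r m
    conv_lhs => rw [pi_eq_sum_univ' r]
    simp [f]
  have hf : Function.Injective f := by
    rw [injective_iff_map_eq_zero]
    intro m hm
    apply eval_injective M hM
    rw [map_zero]
    ext ξ
    obtain ⟨r, rfl⟩ := hc ξ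
    simp [hcf, hm]
  have h : SES f (LinearMap.range f).mkQ :=
    ⟨hf, LinearMap.exact_map_mkQ_range f, Submodule.mkQ_surjective _⟩
  refine ⟨n, f, hf, fun i => ?_⟩
  cases i with
  | zero =>
    refine h.ext_one fun φ => ?_
    obtain ⟨r, rfl⟩ := hc φ
    refine ⟨∑ j, r j • LinearMap.proj j, ?_⟩
    ext m
    simp [hcf]
  | succ i => exact h.ext_right (hM i)

end Ext

section Stable

variable (R : Type u) [CommRing R]

/-- The category of maximal Cohen-Macaulay modules, a full subcategory of the category of modules. -/
abbrev CM : Type (u + 1) := (isMCM R).FullSubcategory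

/-- Two homomorphisms are identified if their difference factors through a free module. -/
def stableRel : HomRel (CM R) := fun M N f g =>
  ∃ (F : ModuleCat.{u} R) (_ : Module.Free R F) (a : M.obj ⟶ F) (b : F ⟶ N.obj),
    f.hom - g.hom = a ≫ b

instance : Congruence (stableRel R) where
  equivalence := fun {M N} =>
    { refl := fun f => ⟨ModuleCat.of R PUnit, inferInstance, 0, 0, by simp⟩
      symm := by
        rintro f g ⟨F, hF, a, b, h⟩
        exact ⟨F, hF, -a, b, by rw [Preadditive.neg_comp, ← h, neg_sub]⟩
      trans := by
        rintro f g k ⟨F, hF, a, b, h⟩ ⟨F', hF', a', b', h'⟩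
        have := hF
        have := hF'
        refine ⟨ModuleCat.of R (F × F'), inferInstanceAs (Module.Free R (F × F')),
          ModuleCat.ofHom (a.hom.prod a'.hom), ModuleCat.ofHom (b.hom.coprod b'.hom), ?_⟩
        rw [← sub_add_sub_cancel, h, h']
        ext x
        simp }
  comp_left := by
    rintro L M N e f g ⟨F, hF, a, b, h⟩
    refine ⟨F, hF, e.hom ≫ a, b, ?_⟩
    rw [Category.assoc, ← h, Preadditive.comp_sub]
    rfl
  comp_right := by
    rintro L M N f g e ⟨F, hF, a, b, h⟩
    refine ⟨F, hF, a, b ≫ e.hom, ?_⟩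
    rw [← Category.assoc, ← h, Preadditive.sub_comp]
    rfl

lemma stableRel_add ⦃M N : CM R⦄ (f₁ f₂ g₁ g₂ : M ⟶ N) (h : stableRel R f₁ f₂)
    (h' : stableRel R g₁ g₂) : stableRel R (f₁ + g₁) (f₂ + g₂) := by
  obtain ⟨F, hF, a, b, h⟩ := h
  obtain ⟨F', hF', a', b', h'⟩ := h'
  have := hF
  have := hF'
  refine ⟨ModuleCat.of R (F × F'), inferInstanceAs (Module.Free R (F × F')),
    ModuleCat.ofHom (a.hom.prod a'.hom), ModuleCat.ofHom (b.hom.coprod b'.hom), ?_⟩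
  have : (f₁ + g₁).hom - (f₂ + g₂).hom = (f₁.hom - f₂.hom) + (g₁.hom - g₂.hom) := by
    change (f₁.hom + g₁.hom) - (f₂.hom + g₂.hom) = _
    abel
  rw [this, h, h']
  ext x
  simp

/-- The stable category of maximal Cohen-Macaulay modules: the same objects as `CM R`, and
homomorphisms modulo those that factor through a free module. -/
def StableCM : Type (u + 1) := CategoryTheory.Quotient (stableRel R)

lemma stableRel_smul (s : R) ⦃M N : CM R⦄ (f g : M ⟶ N) (h : stableRel R f g) :
    stableRel R (s • f) (s • g) := by
  obtain ⟨F, hF, a, b, h⟩ := h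
  refine ⟨F, hF, s • a, b, ?_⟩
  rw [Linear.smul_comp, ← h, smul_sub]
  rfl

namespace StableCM

instance : Category (StableCM R) := inferInstanceAs (Category (CategoryTheory.Quotient _))

instance : Preadditive (StableCM R) :=
  CategoryTheory.Quotient.preadditive (stableRel R) (stableRel_add R)

/-- The projection from `CM R` to the stable category. -/
def quotient : CM R ⥤ StableCM R := CategoryTheory.Quotient.functor (stableRel R)

instance : (quotient R).Additive :=
  CategoryTheory.Quotient.functor_additive (stableRel R) (stableRel_add R)

instance : Linear R (StableCM R) :=
  letI : Preadditive (CategoryTheory.Quotient (stableRel R)) :=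
    CategoryTheory.Quotient.preadditive (stableRel R) (stableRel_add R)
  haveI : (CategoryTheory.Quotient.functor (stableRel R)).Additive :=
    CategoryTheory.Quotient.functor_additive (stableRel R) (stableRel_add R)
  CategoryTheory.Quotient.linear R (stableRel R) (stableRel_smul R)

instance : (quotient R).Linear R :=
  letI : Preadditive (CategoryTheory.Quotient (stableRel R)) :=
    CategoryTheory.Quotient.preadditive (stableRel R) (stableRel_add R)
  haveI : (CategoryTheory.Quotient.functor (stableRel R)).Additive :=
    CategoryTheory.Quotient.functor_additive (stableRel R) (stableRel_add R)
  CategoryTheory.Quotient.linear_functor R (stableRel R) (stableRel_smul R)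

instance : (quotient R).Full := inferInstanceAs (CategoryTheory.Quotient.functor _).Full
instance : (quotient R).EssSurj := inferInstanceAs (CategoryTheory.Quotient.functor _).EssSurj

/-- The module underlying an object of the stable category. -/
def module (M : StableCM R) : ModuleCat.{u} R := (CategoryTheory.Quotient.as M : CM R).obj

lemma quotient_map_eq_iff {M N : CM R} (f g : M ⟶ N) :
    (quotient R).map f = (quotient R).map g ↔ stableRel R f g :=
  CategoryTheory.Quotient.functor_map_eq_iff (stableRel R) f g

end StableCM

end Stable

section Sequences

lemma exists_int_seq {A : ℤ → Type v} (r : ∀ n, A n → A (n + 1) → Prop)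
    (hr : ∀ n a, ∃ b, r n a b) (hl : ∀ n b, ∃ a, r n a b) (n₀ : ℤ) (a₀ : A n₀) :
    ∃ a : ∀ n, A n, a n₀ = a₀ ∧ ∀ n, r n (a n) (a (n + 1)) := by
  have hl' : ∀ (m n : ℤ) (h : m + 1 = n) (b : A n), ∃ a : A m, r m a (h ▸ b) := by
    rintro m n rfl b
    exact hl m b
  choose F hF using hr
  choose G hG using hl'
  let a : ∀ n, A n := fun n => Int.inductionOn' (motive := A) n n₀ a₀ (fun k _ x => F k x)
    (fun k _ x => G (k - 1) k (by ring) x)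
  have ha₀ : a n₀ = a₀ := Int.inductionOn'_self
  refine ⟨a, ha₀, fun n => ?_⟩
  rcases le_or_gt n₀ n with h | h
  · have : a (n + 1) = F n (a n) := Int.inductionOn'_add_one h
    rw [this]
    exact hF _ _
  · obtain ⟨k, rfl⟩ : ∃ k, n = k - 1 := ⟨n + 1, by ring⟩
    have : a (k - 1) = G (k - 1) k (by ring) (a k) := Int.inductionOn'_sub_one (by omega)
    rw [this]
    have key : ∀ (j : ℤ) (e : k - 1 + 1 = j), r (k - 1) (G (k - 1) j e (a j)) (a (k - 1 + 1)) := by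
      rintro _ rfl
      exact hG _ _ rfl _
    exact key k (by ring)

end Sequences

section Complexes

/-- Finitely generated free modules. -/
def fgFree (R : Type u) [CommRing R] : ObjectProperty (ModuleCat.{u} R) :=
  fun M => Module.Finite R M ∧ Module.Free R M

/-- The category of finitely generated free modules. -/
abbrev FreeMod (R : Type u) [CommRing R] : Type (u + 1) := (fgFree R).FullSubcategory

variable {R : Type u} [CommRing R]

instance : (fgFree R).IsClosedUnderIsomorphisms where
  of_iso e h :=
    ⟨have := h.1; Module.Finite.equiv e.toLinearEquiv,
      have := h.2; Module.Free.of_equiv e.toLinearEquiv⟩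

instance : (fgFree R).ContainsZero where
  exists_zero := ⟨ModuleCat.of R PUnit.{u + 1}, ModuleCat.isZero_of_subsingleton _,
    ⟨inferInstanceAs (Module.Finite R PUnit.{u + 1}),
      inferInstanceAs (Module.Free R PUnit.{u + 1})⟩⟩

instance : (fgFree R).IsClosedUnderBinaryProducts := by
  refine .mk' ?_
  rintro _ ⟨F, hF⟩
  let M := F.obj ⟨WalkingPair.left⟩
  let N := F.obj ⟨WalkingPair.right⟩
  have e : limit F ≅ ModuleCat.of R (M × N) :=
    (HasLimit.isoOfNatIso (diagramIsoPair F)) ≪≫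
      (biprod.isoProd _ _).symm ≪≫ ModuleCat.biprodIsoProd M N
  have := (hF ⟨WalkingPair.left⟩).1
  have := (hF ⟨WalkingPair.left⟩).2
  have := (hF ⟨WalkingPair.right⟩).1
  have := (hF ⟨WalkingPair.right⟩).2
  refine (fgFree R).prop_of_iso e.symm ⟨inferInstanceAs (Module.Finite R (M × N)),
    inferInstanceAs (Module.Free R (M × N))⟩

instance : HasBinaryBiproducts (FreeMod R) := HasBinaryBiproducts.of_hasBinaryProducts

variable (R) in
/-- The complexes of finitely generated free modules (up to homotopy) that are exact as complexes
of modules. -/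
def acyclic : ObjectProperty (HomotopyCategory (FreeMod R) (ComplexShape.up ℤ)) :=
  (HomotopyCategory.subcategoryAcyclic (ModuleCat.{u} R)).inverseImage
    ((fgFree R).ι.mapHomotopyCategory (ComplexShape.up ℤ))

instance : (acyclic R).IsTriangulated := by unfold acyclic; infer_instance
instance : (acyclic R).IsClosedUnderIsomorphisms := by unfold acyclic; infer_instance

/-- The differential of a complex of free modules. -/
abbrev d (K : CochainComplex (FreeMod R) ℤ) (n : ℤ) : (K.X n).obj →ₗ[R] (K.X (n + 1)).obj :=
  (K.d n (n + 1)).hom.hom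

lemma d_d (K : CochainComplex (FreeMod R) ℤ) (n : ℤ) (x : (K.X n).obj) :
    d K (n + 1) (d K n x) = 0 := by
  have := congrArg (fun f => f.hom.hom x) (K.d_comp_d n (n + 1) (n + 1 + 1))
  exact this

/-- The module of cocycles of a complex of free modules. -/
abbrev cycles (K : CochainComplex (FreeMod R) ℤ) (n : ℤ) : Submodule R (K.X n).obj :=
  LinearMap.ker (d K n)

/-- The differential, with values in the cocycles. -/
abbrev toCycles (K : CochainComplex (FreeMod R) ℤ) (n : ℤ) :
    (K.X n).obj →ₗ[R] cycles K (n + 1) :=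
  (d K n).codRestrict _ fun x => d_d K n x

instance (K : CochainComplex (FreeMod R) ℤ) (n : ℤ) : Module.Finite R (K.X n).obj := (K.X n).property.1
instance (K : CochainComplex (FreeMod R) ℤ) (n : ℤ) : Module.Free R (K.X n).obj := (K.X n).property.2

lemma acyclic_iff (K : CochainComplex (FreeMod R) ℤ) :
    acyclic R ((HomotopyCategory.quotient _ _).obj K) ↔
      ∀ n, Function.Surjective (toCycles K n) := by
  have h1 : acyclic R ((HomotopyCategory.quotient _ _).obj K) ↔
      ∀ n, (((fgFree R).ι.mapHomologicalComplex _).obj K).ExactAt n :=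
    HomotopyCategory.quotient_obj_mem_subcategoryAcyclic_iff_exactAt
      (((fgFree R).ι.mapHomologicalComplex (ComplexShape.up ℤ)).obj K)
  rw [h1]
  have h2 : ∀ n : ℤ, (((fgFree R).ι.mapHomologicalComplex _).obj K).ExactAt (n + 1) ↔
      Function.Surjective (toCycles K n) := by
    intro n
    rw [HomologicalComplex.exactAt_iff' _ n (n + 1) (n + 1 + 1) (by simp) (by simp),
      ShortComplex.moduleCat_exact_iff]
    constructor
    · rintro h ⟨x, hx⟩
      obtain ⟨y, hy⟩ := h x hx
      exact ⟨y, Subtype.ext hy⟩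
    · intro h x hx
      obtain ⟨y, hy⟩ := h ⟨x, hx⟩
      exact ⟨y, congrArg Subtype.val hy⟩
  refine ⟨fun h n => (h2 n).1 (h _), fun h n => ?_⟩
  obtain ⟨m, rfl⟩ : ∃ m, n = m + 1 := ⟨n - 1, by ring⟩
  exact (h2 m).2 (h m)

lemma ses_cycles {K : CochainComplex (FreeMod R) ℤ} (hK : ∀ n, Function.Surjective (toCycles K n))
    (n : ℤ) : SES (cycles K n).subtype (toCycles K n) :=
  ⟨Subtype.val_injective, fun x => by
    rw [Submodule.coe_subtype, Subtype.range_coe]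
    exact Subtype.ext_iff, hK n⟩

lemma cycles_van [IsGorensteinLocalRing R] {K : CochainComplex (FreeMod R) ℤ}
    (hK : ∀ n, Function.Surjective (toCycles K n)) (n : ℤ) : ExtVan (R := R) (cycles K n) := by
  obtain ⟨b, hb⟩ := exists_bound R
  have key : ∀ k : ℕ, ∀ (n : ℤ) (i : ℕ), b ≤ i + k → ExtZero (R := R) (cycles K n) (i + 1) := by
    intro k
    induction k with
    | zero => exact fun n i hi => hb _ _ (by omega)
    | succ k ih => exact fun n i hi => (ses_cycles hK n).ext_left (ih _ _ (by omega))
  exact fun i => key b n i (by omega)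

lemma isMCM_of {M : Type u} [AddCommGroup M] [Module R M] [Module.Finite R M]
    (h : ExtVan (R := R) M) : isMCM R (ModuleCat.of R M) := by
  refine ⟨inferInstance, fun i hi => ?_⟩
  obtain ⟨j, rfl⟩ : ∃ j, i = j + 1 := ⟨i - 1, by omega⟩
  exact h j

lemma comm_apply {K L : CochainComplex (FreeMod R) ℤ} (φ : K ⟶ L) (n : ℤ) (x : (K.X n).obj) :
    d L n ((φ.f n).hom.hom x) = (φ.f (n + 1)).hom.hom (d K n x) := by
  have := congrArg (fun f => f.hom.hom x) (φ.comm n (n + 1))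
  exact this

/-- The map induced on cocycles by a morphism of complexes. -/
abbrev cyclesMap {K L : CochainComplex (FreeMod R) ℤ} (φ : K ⟶ L) (n : ℤ) :
    cycles K n →ₗ[R] cycles L n :=
  (φ.f n).hom.hom.restrict fun x hx => by
    rw [LinearMap.mem_ker] at hx ⊢
    rw [comm_apply, hx, map_zero]

lemma cyclesMap_homotopy {K L : CochainComplex (FreeMod R) ℤ} {φ ψ : K ⟶ L} (h : Homotopy φ ψ)
    (n : ℤ) : ∃ (P : ModuleCat.{u} R) (_ : Module.Free R P) (a : cycles K n →ₗ[R] P)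
      (b : P →ₗ[R] cycles L n), cyclesMap φ n - cyclesMap ψ n = b ∘ₗ a := by
  obtain ⟨m, rfl⟩ : ∃ m, n = m + 1 := ⟨n - 1, by ring⟩
  refine ⟨(L.X m).obj, inferInstance, (h.hom (m + 1) m).hom.hom ∘ₗ (cycles K (m + 1)).subtype,
    toCycles L m, ?_⟩
  ext x
  have := congrArg (fun f => f.hom.hom x.1) (h.comm (m + 1))
  rw [dNext_eq h.hom (i' := m + 1 + 1) (by simp), prevD_eq h.hom (j' := m) (by simp)] at this
  have hx : d K (m + 1) x.1 = 0 := x.2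
  change (φ.f (m + 1)).hom.hom x.1 = (h.hom (m + 1 + 1) (m + 1)).hom.hom (d K (m + 1) x.1) +
    d L m ((h.hom (m + 1) m).hom.hom x.1) + (ψ.f (m + 1)).hom.hom x.1 at this
  rw [hx, map_zero, zero_add] at this
  change (φ.f (m + 1)).hom.hom x.1 - (ψ.f (m + 1)).hom.hom x.1 =
    d L m ((h.hom (m + 1) m).hom.hom x.1)
  rw [this, add_sub_cancel_right]

variable (R) in
/-- The homotopy category of exact complexes of finitely generated free modules, with its usual
triangulated structure (shifts of complexes and mapping cones). -/
abbrev AcyclicHo : Type (u + 1) := (acyclic R).FullSubcategory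

/-- The complex underlying an object. -/
def AcyclicHo.cx (X : AcyclicHo R) : CochainComplex (FreeMod R) ℤ :=
  CategoryTheory.Quotient.as X.obj

lemma AcyclicHo.surj (X : AcyclicHo R) (n : ℤ) : Function.Surjective (toCycles X.cx n) :=
  (acyclic_iff X.cx).1 X.property n

/-- A morphism of complexes representing a morphism. -/
noncomputable def AcyclicHo.rep {X Y : AcyclicHo R} (f : X ⟶ Y) : X.cx ⟶ Y.cx :=
  (HomotopyCategory.quotient (FreeMod R) (ComplexShape.up ℤ)).preimage f.hom

lemma AcyclicHo.map_rep {X Y : AcyclicHo R} (f : X ⟶ Y) :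
    (HomotopyCategory.quotient (FreeMod R) (ComplexShape.up ℤ)).map (AcyclicHo.rep f) = f.hom :=
  Functor.map_preimage _ _

/-- The homotopy class of a morphism of complexes. -/
def AcyclicHo.mk {X Y : AcyclicHo R} (f : X.cx ⟶ Y.cx) : X ⟶ Y :=
  (acyclic R).homMk ((HomotopyCategory.quotient (FreeMod R) (ComplexShape.up ℤ)).map f)

lemma AcyclicHo.mk_rep {X Y : AcyclicHo R} (f : X ⟶ Y) : AcyclicHo.mk (AcyclicHo.rep f) = f := by
  ext1
  exact AcyclicHo.map_rep f

lemma AcyclicHo.mk_id (X : AcyclicHo R) : AcyclicHo.mk (𝟙 X.cx) = 𝟙 X := by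
  ext1
  exact (HomotopyCategory.quotient (FreeMod R) (ComplexShape.up ℤ)).map_id X.cx

lemma AcyclicHo.mk_comp {X Y W : AcyclicHo R} (f : X.cx ⟶ Y.cx) (g : Y.cx ⟶ W.cx) :
    (AcyclicHo.mk (f ≫ g) : X ⟶ W) = AcyclicHo.mk f ≫ AcyclicHo.mk g := by
  ext1
  exact (HomotopyCategory.quotient (FreeMod R) (ComplexShape.up ℤ)).map_comp f g

lemma AcyclicHo.mk_add {X Y : AcyclicHo R} (f g : X.cx ⟶ Y.cx) :
    (AcyclicHo.mk (f + g) : X ⟶ Y) = AcyclicHo.mk f + AcyclicHo.mk g := by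
  ext1
  exact (HomotopyCategory.quotient (FreeMod R) (ComplexShape.up ℤ)).map_add (f := f) (g := g)

lemma AcyclicHo.mk_smul {X Y : AcyclicHo R} (s : R) (f : X.cx ⟶ Y.cx) :
    (AcyclicHo.mk (s • f) : X ⟶ Y) = s • AcyclicHo.mk f := by
  ext1
  exact Functor.Linear.map_smul (F := HomotopyCategory.quotient (FreeMod R) (ComplexShape.up ℤ)) f s

variable [IsGorensteinLocalRing R]

/-- The zeroth module of cocycles of an exact complex of finitely generated free modules is
maximal Cohen-Macaulay. -/
noncomputable def cyclesCM (X : AcyclicHo R) : CM R :=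
  ⟨ModuleCat.of R (cycles X.cx 0), isMCM_of (cycles_van X.surj 0)⟩

/-- The map induced on the zeroth modules of cocycles. -/
noncomputable def cyclesCMMap {X Y : AcyclicHo R} (f : X.cx ⟶ Y.cx) :
    cyclesCM X ⟶ cyclesCM Y :=
  (isMCM R).homMk (ModuleCat.ofHom (cyclesMap f 0))

lemma quotient_cyclesCMMap {X Y : AcyclicHo R} (f g : X.cx ⟶ Y.cx)
    (h : AcyclicHo.mk f = AcyclicHo.mk g) :
    (StableCM.quotient R).map (cyclesCMMap f) = (StableCM.quotient R).map (cyclesCMMap g) := by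
  rw [StableCM.quotient_map_eq_iff]
  obtain ⟨P, hP, a, b, e⟩ := cyclesMap_homotopy
    (HomotopyCategory.homotopyOfEq f g (congrArg (fun φ => φ.hom) h)) 0
  exact ⟨P, hP, ModuleCat.ofHom a, ModuleCat.ofHom b, by ext1; exact e⟩

variable (R) in
/-- The functor sending an exact complex of finitely generated free modules to its zeroth module of
cocycles. It is an equivalence (see the instances below): an inverse sends a module to a complete
resolution of it. -/
noncomputable def cyclesFunctor : AcyclicHo R ⥤ StableCM R where
  obj X := (StableCM.quotient R).obj (cyclesCM X)
  map f := (StableCM.quotient R).map (cyclesCMMap (AcyclicHo.rep f))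
  map_id X := by
    rw [quotient_cyclesCMMap (AcyclicHo.rep (𝟙 X)) (𝟙 _)]
    · exact (StableCM.quotient R).map_id (cyclesCM X)
    · rw [AcyclicHo.mk_rep, AcyclicHo.mk_id]
  map_comp {X Y W} f g := by
    rw [quotient_cyclesCMMap (AcyclicHo.rep (f ≫ g)) (AcyclicHo.rep f ≫ AcyclicHo.rep g)]
    · exact (StableCM.quotient R).map_comp (cyclesCMMap (AcyclicHo.rep f)) (cyclesCMMap (AcyclicHo.rep g))
    · rw [AcyclicHo.mk_comp, AcyclicHo.mk_rep, AcyclicHo.mk_rep, AcyclicHo.mk_rep]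

lemma cyclesFunctor_map_mk {X Y : AcyclicHo R} (f : X.cx ⟶ Y.cx) :
    (cyclesFunctor R).map (AcyclicHo.mk f) = (StableCM.quotient R).map (cyclesCMMap f) :=
  quotient_cyclesCMMap _ _ (AcyclicHo.mk_rep _)

instance : (cyclesFunctor R).Additive where
  map_add {X Y f g} := by
    refine (quotient_cyclesCMMap (AcyclicHo.rep (f + g)) (AcyclicHo.rep f + AcyclicHo.rep g) ?_).trans
      ?_
    · rw [AcyclicHo.mk_add, AcyclicHo.mk_rep, AcyclicHo.mk_rep, AcyclicHo.mk_rep]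
    · exact (StableCM.quotient R).map_add (f := cyclesCMMap (AcyclicHo.rep f))
        (g := cyclesCMMap (AcyclicHo.rep g))

instance : (cyclesFunctor R).Linear R where
  map_smul {X Y} f s := by
    refine (quotient_cyclesCMMap (AcyclicHo.rep (s • f)) (s • AcyclicHo.rep f) ?_).trans ?_
    · rw [AcyclicHo.mk_smul, AcyclicHo.mk_rep, AcyclicHo.mk_rep]
    · exact Functor.Linear.map_smul (F := StableCM.quotient R) (cyclesCMMap (AcyclicHo.rep f)) s

lemma exists_lift_cycles {K L : CochainComplex (FreeMod R) ℤ}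
    (hK : ∀ n, Function.Surjective (toCycles K n)) (hL : ∀ n, Function.Surjective (toCycles L n))
    (n₀ : ℤ) (φ : cycles K n₀ →ₗ[R] cycles L n₀) : ∃ f : K ⟶ L, cyclesMap f n₀ = φ := by
  obtain ⟨a, rfl, ha⟩ := exists_int_seq (A := fun n => cycles K n →ₗ[R] cycles L n)
    (fun n a b => ∃ f : (K.X n).obj →ₗ[R] (L.X n).obj, (∀ x : cycles K n, f x = a x) ∧
      ∀ y, toCycles L n (f y) = b (toCycles K n y)) (by
        intro n a
        obtain ⟨f, hf⟩ := (ses_cycles hK n).extend (cycles_van hK (n + 1) 0)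
          ((cycles L n).subtype ∘ₗ a)
        have hf0 : ∀ x : cycles K n, f x = a x := fun x => LinearMap.congr_fun hf x
        refine ⟨((LinearMap.ker (toCycles K n)).liftQ (toCycles L n ∘ₗ f) ?_) ∘ₗ
          ((toCycles K n).quotKerEquivOfSurjective (hK n)).symm.toLinearMap, f, hf0, fun y => ?_⟩
        · intro x hx
          have hx' : d K n x = 0 := congrArg Subtype.val hx
          rw [LinearMap.mem_ker, LinearMap.comp_apply, hf0 ⟨x, hx'⟩]
          exact Subtype.ext (a ⟨x, hx'⟩).2
        · have : ((toCycles K n).quotKerEquivOfSurjective (hK n)).symm (toCycles K n y) =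
              Submodule.Quotient.mk y := by
            rw [LinearEquiv.symm_apply_eq]; rfl
          simp only [LinearMap.comp_apply, LinearEquiv.coe_coe, this, Submodule.liftQ_apply]) (by
        intro n b
        obtain ⟨f, hf⟩ := Module.projective_lifting_property (toCycles L n) (b ∘ₗ toCycles K n) (hL n)
        have hf0 : ∀ y, toCycles L n (f y) = b (toCycles K n y) := fun y => LinearMap.congr_fun hf y
        refine ⟨f.restrict fun x hx => ?_, f, fun x => rfl, hf0⟩
        have h1 : toCycles K n x = 0 := Subtype.ext hx
        have h2 := hf0 x
        rw [h1, map_zero] at h2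
        exact congrArg Subtype.val h2) n₀ φ
  choose f hf hf' using ha
  refine ⟨⟨fun n => (fgFree R).homMk (ModuleCat.ofHom (f n)), ?_⟩, ?_⟩
  · rintro i _ rfl
    ext y
    have h1 := congrArg Subtype.val (hf' i y)
    have h2 := hf (i + 1) (toCycles K i y)
    exact h1.trans h2.symm
  · ext x
    exact hf n₀ x

lemma homotopy_zero_of_cycles {K L : CochainComplex (FreeMod R) ℤ}
    (hK : ∀ n, Function.Surjective (toCycles K n)) (hL : ∀ n, Function.Surjective (toCycles L n))
    (f : K ⟶ L) (n₀ : ℤ) {P : Type u} [AddCommGroup P] [Module R P] [Module.Free R P]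
    (a : cycles K n₀ →ₗ[R] P) (b : P →ₗ[R] cycles L n₀) (hab : cyclesMap f n₀ = b ∘ₗ a) :
    Nonempty (Homotopy f 0) := by
  obtain ⟨n₀, rfl⟩ : ∃ m, n₀ = m + 1 := ⟨n₀ - 1, by ring⟩
  obtain ⟨b', hb'⟩ := Module.projective_lifting_property (toCycles L n₀) b (hL n₀)
  obtain ⟨t, -, ht⟩ := exists_int_seq
    (A := fun n => {t : cycles K (n + 1) →ₗ[R] (L.X n).obj //
      ∀ x, toCycles L n (t x) = cyclesMap f (n + 1) x})
    (fun n t t' => ∃ s : (K.X (n + 1)).obj →ₗ[R] (L.X n).obj,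
      (∀ x : cycles K (n + 1), s x = t.1 x) ∧
      ∀ y, (f.f (n + 1)).hom.hom y = d L n (s y) + t'.1 (toCycles K (n + 1) y)) (by
        rintro n ⟨t, ht⟩
        obtain ⟨s, hs⟩ := (ses_cycles hK (n + 1)).extend (cycles_van hK (n + 1 + 1) 0) t
        have hs0 : ∀ x : cycles K (n + 1), s x = t x := fun x => LinearMap.congr_fun hs x
        let g : (K.X (n + 1)).obj →ₗ[R] (L.X (n + 1)).obj := (f.f (n + 1)).hom.hom - d L n ∘ₗ s
        let t' : cycles K (n + 1 + 1) →ₗ[R] (L.X (n + 1)).obj :=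
          ((LinearMap.ker (toCycles K (n + 1))).liftQ g (by
            intro x hx
            have hx' : d K (n + 1) x = 0 := congrArg Subtype.val hx
            have h1 := congrArg Subtype.val (ht ⟨x, hx'⟩)
            rw [← hs0] at h1
            exact sub_eq_zero.2 h1.symm)) ∘ₗ
          ((toCycles K (n + 1)).quotKerEquivOfSurjective (hK (n + 1))).symm.toLinearMap
        have ht' : ∀ y, t' (toCycles K (n + 1) y) = g y := by
          intro y
          have : ((toCycles K (n + 1)).quotKerEquivOfSurjective (hK (n + 1))).symm
              (toCycles K (n + 1) y) = Submodule.Quotient.mk y := by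
            rw [LinearEquiv.symm_apply_eq]; rfl
          simp only [t', LinearMap.comp_apply, LinearEquiv.coe_coe, this]
          rfl
        refine ⟨⟨t', fun x => ?_⟩, s, hs0, fun y => ?_⟩
        · obtain ⟨y, rfl⟩ := hK (n + 1) x
          rw [ht']
          apply Subtype.ext
          change d L (n + 1) ((f.f (n + 1)).hom.hom y - d L n (s y)) = _
          rw [map_sub, d_d, sub_zero, comm_apply]
          rfl
        · rw [ht']
          change _ = d L n (s y) + ((f.f (n + 1)).hom.hom y - d L n (s y))
          abel) (by
        rintro n ⟨t', ht'⟩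
        let g : (K.X (n + 1)).obj →ₗ[R] cycles L (n + 1) :=
          ((f.f (n + 1)).hom.hom - t' ∘ₗ toCycles K (n + 1)).codRestrict _ (by
            intro y
            have h1 := congrArg Subtype.val (ht' (toCycles K (n + 1) y))
            rw [LinearMap.mem_ker, LinearMap.sub_apply, map_sub, comm_apply]
            exact sub_eq_zero.2 h1.symm)
        obtain ⟨s, hs⟩ := Module.projective_lifting_property (toCycles L n) g (hL n)
        have hs0 : ∀ y, toCycles L n (s y) = g y := fun y => LinearMap.congr_fun hs y
        refine ⟨⟨s ∘ₗ (cycles K (n + 1)).subtype, fun x => ?_⟩, s, fun x => rfl, fun y => ?_⟩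
        · refine (hs0 x).trans (Subtype.ext ?_)
          change (f.f (n + 1)).hom.hom x.1 - t' (toCycles K (n + 1) x.1) = (f.f (n + 1)).hom.hom x.1
          have : toCycles K (n + 1) x.1 = 0 := Subtype.ext x.2
          rw [this, map_zero, sub_zero]
        · have h1 : d L n (s y) = (f.f (n + 1)).hom.hom y - t' (toCycles K (n + 1) y) :=
            congrArg Subtype.val (hs0 y)
          rw [h1, sub_add_cancel]) n₀
      ⟨b' ∘ₗ a, fun x => by
        rw [hab]
        exact LinearMap.congr_fun hb' (a x)⟩
  choose s hs hs' using ht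
  let h : ∀ i j, (ComplexShape.up ℤ).Rel j i → (K.X i ⟶ L.X j) := fun i j e =>
    (fgFree R).homMk (ModuleCat.ofHom ((s j).comp (by
      obtain rfl : j + 1 = i := e
      exact LinearMap.id)))
  have : f = Homotopy.nullHomotopicMap' h := by
    ext n : 1
    obtain ⟨m, rfl⟩ : ∃ m, n = m + 1 := ⟨n - 1, by ring⟩
    rw [Homotopy.nullHomotopicMap'_f (k₂ := m) (k₀ := m + 1 + 1) (by simp) (by simp)]
    ext y
    refine (hs' m y).trans ?_
    have h1 := hs (m + 1) (toCycles K (m + 1) y)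
    refine (add_comm _ _).trans (congrArg (· + d L m (s m y)) h1.symm)
  rw [this]
  exact ⟨Homotopy.nullHomotopy' h⟩

lemma exists_complete_resolution (M : CM R) :
    ∃ (K : CochainComplex (FreeMod R) ℤ) (_ : ∀ n, Function.Surjective (toCycles K n)),
      Nonempty (cycles K 0 ≃ₗ[R] M.obj) := by
  have fin (M : CM R) : Module.Finite R M.obj := M.property.1
  have van (M : CM R) : ExtVan (R := R) M.obj := fun i => M.property.2 (i + 1) (by omega)
  obtain ⟨M, rfl, h⟩ := exists_int_seq (A := fun _ => CM R)
    (fun n M N => ∃ (k : ℕ) (i : M.obj →ₗ[R] (Fin k → R)) (p : (Fin k → R) →ₗ[R] N.obj), SES i p)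
    (by
        intro _ M
        have := fin M
        obtain ⟨n, f, hf, h⟩ := exists_cosyzygy M.obj (van M)
        exact ⟨⟨ModuleCat.of R ((Fin n → R) ⧸ LinearMap.range f), isMCM_of h⟩, n, f,
          (LinearMap.range f).mkQ, hf, LinearMap.exact_map_mkQ_range f, Submodule.mkQ_surjective _⟩) (by
        intro _ M
        have := fin M
        obtain ⟨n, g, hg⟩ := exists_cover R M.obj
        exact ⟨⟨ModuleCat.of R (LinearMap.ker g), isMCM_of ((ses_ker g hg).van_left (van M))⟩, n, _, g,
          ses_ker g hg⟩) 0 M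
  choose k i p hip using h
  let K : CochainComplex (FreeMod R) ℤ := CochainComplex.of
    (fun n => ⟨ModuleCat.of R (Fin (k n) → R), inferInstanceAs (Module.Finite R (Fin (k n) → R)),
      inferInstanceAs (Module.Free R (Fin (k n) → R))⟩)
    (fun n => (fgFree R).homMk (ModuleCat.ofHom (i (n + 1) ∘ₗ p n))) (by
      intro n
      ext1
      ext1
      refine LinearMap.ext fun x => ?_
      change i (n + 1 + 1) (p (n + 1) (i (n + 1) (p n x))) = 0
      rw [(hip (n + 1)).exact.apply_apply_eq_zero, map_zero])
  have hd : ∀ n, d K n = i (n + 1) ∘ₗ p n := fun n => by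
    simp only [d, K, CochainComplex.of_d]
    rfl
  have hc : ∀ n, cycles K n = LinearMap.range (i n) := fun n => by
    ext x
    rw [LinearMap.mem_ker, hd, LinearMap.comp_apply,
      (injective_iff_map_eq_zero' _).1 (hip (n + 1)).inj]
    exact (hip n).exact x
  refine ⟨K, fun n x => ?_, ⟨(LinearEquiv.ofEq _ _ (hc 0)).trans
    (LinearEquiv.ofInjective _ (hip 0).inj).symm⟩⟩
  have hx : x.1 ∈ LinearMap.range (i (n + 1)) := hc (n + 1) ▸ x.2
  obtain ⟨m, hm⟩ := hx
  obtain ⟨y, rfl⟩ := (hip n).surj m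
  refine ⟨y, Subtype.ext (Eq.trans ?_ hm)⟩
  exact LinearMap.congr_fun (hd n) y

instance : (cyclesFunctor R).Full where
  map_surjective {X Y} f := by
    obtain ⟨φ, rfl⟩ := (StableCM.quotient R).map_surjective f
    obtain ⟨g, hg⟩ := exists_lift_cycles X.surj Y.surj 0 φ.hom.hom
    refine ⟨AcyclicHo.mk g, (cyclesFunctor_map_mk g).trans (congrArg _ ?_)⟩
    ext1
    ext1
    exact hg

instance : (cyclesFunctor R).Faithful := by
  refine ⟨fun {X Y f g} hfg => ?_⟩
  obtain ⟨φ, hφ⟩ : ∃ φ : X.cx ⟶ Y.cx, AcyclicHo.mk φ = f - g := ⟨_, AcyclicHo.mk_rep _⟩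
  have h0 : (StableCM.quotient R).map (cyclesCMMap φ) = (StableCM.quotient R).map 0 := by
    rw [← cyclesFunctor_map_mk, hφ, Functor.map_sub, hfg, sub_self]
    exact ((StableCM.quotient R).map_zero _ _).symm
  rw [StableCM.quotient_map_eq_iff] at h0
  obtain ⟨F, hF, a, b, h⟩ := h0
  obtain ⟨H⟩ := homotopy_zero_of_cycles X.surj Y.surj φ 0 a.hom b.hom (by
    have := congrArg ModuleCat.Hom.hom h
    refine Eq.trans ?_ this
    exact (sub_zero (cyclesMap φ 0)).symm)
  rw [← sub_eq_zero, ← hφ]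
  ext1
  exact (HomotopyCategory.eq_of_homotopy _ _ H).trans (Functor.map_zero _ _ _)

instance : (cyclesFunctor R).EssSurj where
  mem_essImage Y := by
    obtain ⟨M, ⟨e⟩⟩ := Functor.EssSurj.mem_essImage (F := StableCM.quotient R) Y
    obtain ⟨K, hK, ⟨e'⟩⟩ := exists_complete_resolution M
    let X : AcyclicHo R := ⟨(HomotopyCategory.quotient _ _).obj K, (acyclic_iff K).2 hK⟩
    exact ⟨X, ⟨(StableCM.quotient R).mapIso ((isMCM R).isoMk (LinearEquiv.toModuleIso e')) ≪≫ e⟩⟩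

instance : (cyclesFunctor R).IsEquivalence where

end Complexes

section Localization

variable {R : Type u} [CommRing R]

lemma free_localization_iff [IsNoetherianRing R] (p : Ideal R) [p.IsPrime] (M : Type u)
    [AddCommGroup M] [Module R M] [Module.Finite R M] :
    Module.Free (Localization.AtPrime p) (LocalizedModule p.primeCompl M) ↔
      ∃ s : R, s ∉ p ∧ ∃ (F : ModuleCat.{u} R) (_ : Module.Free R F) (a : M →ₗ[R] F)
        (b : F →ₗ[R] M), s • LinearMap.id = b ∘ₗ a := by
  constructor
  · intro h
    have := Module.finitePresentation_of_finite R M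
    obtain ⟨n, g, hg⟩ := exists_cover R M
    have hg' : Function.Surjective (LocalizedModule.map p.primeCompl g) :=
      LocalizedModule.map_surjective _ g hg
    obtain ⟨σ, hσ⟩ := Module.projective_lifting_property (LocalizedModule.map p.primeCompl g)
      LinearMap.id hg'
    obtain ⟨h, s, hs⟩ := Module.FinitePresentation.exists_lift_of_isLocalizedModule p.primeCompl
      (LocalizedModule.mkLinearMap p.primeCompl (Fin n → R))
      ((σ.restrictScalars R) ∘ₗ LocalizedModule.mkLinearMap p.primeCompl M)
    obtain ⟨t, ht⟩ := Module.Finite.exists_smul_of_comp_eq_of_isLocalizedModule p.primeCompl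
      (LocalizedModule.mkLinearMap p.primeCompl M) (g ∘ₗ h) (s • LinearMap.id) (by
        ext x
        have h1 := LinearMap.congr_fun hs x
        have h2 := LinearMap.congr_fun hσ (LocalizedModule.mkLinearMap p.primeCompl M x)
        have h3 := congrArg (LocalizedModule.map p.primeCompl g) h1
        have h4 : ∀ y, LocalizedModule.map p.primeCompl g
            (LocalizedModule.mkLinearMap p.primeCompl (Fin n → R) y) =
            LocalizedModule.mkLinearMap p.primeCompl M (g y) := fun y => by
          simp [LocalizedModule.mkLinearMap_apply, LocalizedModule.map_mk]
        change LocalizedModule.map p.primeCompl g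
            (LocalizedModule.mkLinearMap p.primeCompl (Fin n → R) (h x)) =
          LocalizedModule.map p.primeCompl g
            ((s : R) • σ (LocalizedModule.mkLinearMap p.primeCompl M x)) at h3
        rw [h4, LinearMap.map_smul_of_tower] at h3
        refine h3.trans ((congrArg ((s : R) • ·) h2).trans ?_)
        exact (map_smul (LocalizedModule.mkLinearMap p.primeCompl M) (s : R) x).symm)
    refine ⟨t * s, (t * s).2, ModuleCat.of R (Fin n → R),
      inferInstanceAs (Module.Free R (Fin n → R)), h, (t : R) • g, ?_⟩
    ext x
    have := LinearMap.congr_fun ht x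
    change (t : R) • g (h x) = (t : R) • (s : R) • x at this
    change ((t : R) * (s : R)) • x = (t : R) • g (h x)
    rw [this, mul_smul]
  · rintro ⟨s, hs, F, hF, a, b, hab⟩
    let s' : p.primeCompl := ⟨s, hs⟩
    have := hF
    have : Module.Projective (Localization.AtPrime p) (LocalizedModule p.primeCompl M) := by
      refine Module.Projective.of_split (M := LocalizedModule p.primeCompl F)
        (LocalizedModule.map p.primeCompl a)
        ((Localization.mk 1 s' : Localization.AtPrime p) • LocalizedModule.map p.primeCompl b) ?_
      ext x
      induction x using LocalizedModule.induction_on with | _ m t =>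
      have h1 : b (a m) = s • m := (LinearMap.congr_fun hab m).symm
      change (Localization.mk 1 s' : Localization.AtPrime p) • LocalizedModule.map p.primeCompl b
        (LocalizedModule.map p.primeCompl a (LocalizedModule.mk m t)) = LocalizedModule.mk m t
      rw [LocalizedModule.map_mk, LocalizedModule.map_mk, h1, LocalizedModule.mk_smul_mk, one_smul]
      exact LocalizedModule.mk_cancel_common_left s' t m
    exact Module.free_of_flat_of_isLocalRing

lemma StableCM.smul_id_eq_zero_iff (s : R) (M : StableCM R) : s • 𝟙 M = 0 ↔
    ∃ (F : ModuleCat.{u} R) (_ : Module.Free R F) (a : M.module →ₗ[R] F)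
        (b : F →ₗ[R] M.module), s • LinearMap.id = b ∘ₗ a := by
  let N : CM R := CategoryTheory.Quotient.as M
  have h1 : s • 𝟙 M = (quotient R).map (s • 𝟙 N) := by
    rw [Functor.map_smul]
    exact congrArg (s • ·) ((quotient R).map_id N).symm
  have h2 : (0 : M ⟶ M) = (quotient R).map (0 : N ⟶ N) := ((quotient R).map_zero N N).symm
  rw [h1, h2]
  refine (quotient_map_eq_iff R (s • 𝟙 N) 0).trans ?_
  have h3 : (s • 𝟙 N).hom - (0 : N ⟶ N).hom = s • 𝟙 N.obj := sub_zero _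
  constructor
  · rintro ⟨F, hF, a, b, h⟩
    rw [h3] at h
    exact ⟨F, hF, a.hom, b.hom, congrArg ModuleCat.Hom.hom h⟩
  · rintro ⟨F, hF, a, b, h⟩
    refine ⟨F, hF, ModuleCat.ofHom a, ModuleCat.ofHom b, h3.trans ?_⟩
    ext1
    exact h

end Localization

section Triangulated

variable (R : Type u) [CommRing R] [IsGorensteinLocalRing R]

namespace StableCM

/-- The suspension of the stable category. For an exact complex `K` of finitely generated free
modules, the suspension of `Z⁰ K` is `Z⁰ (K⟦1⟧) = Z¹ K`, that is, a cosyzygy of `Z⁰ K`: the cokernel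
of the embedding of `Z⁰ K` into the free module `K⁰`. -/
noncomputable instance : HasShift (StableCM R) ℤ :=
  HasShift.induced (cyclesFunctor R) ℤ
    (fun n => (cyclesFunctor R).inv ⋙ shiftFunctor (AcyclicHo R) n ⋙ cyclesFunctor R)
    (fun _ => (Functor.associator _ _ _).symm ≪≫
      Functor.isoWhiskerRight (cyclesFunctor R).asEquivalence.unitIso.symm _ ≪≫
        Functor.leftUnitor _)

noncomputable instance : (cyclesFunctor R).CommShift ℤ :=
  Functor.CommShift.ofInduced _ _ _ _

instance : HasZeroObject (StableCM R) where
  zero := ⟨_, (cyclesFunctor R).map_isZero (isZero_zero _)⟩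

instance (n : ℤ) : (shiftFunctor (StableCM R) n).Additive := by
  have : (cyclesFunctor R).inv.Additive := by
    have : (cyclesFunctor R).asEquivalence.functor.Additive :=
      inferInstanceAs (cyclesFunctor R).Additive
    exact (cyclesFunctor R).asEquivalence.inverse_additive
  exact inferInstanceAs
    ((cyclesFunctor R).inv ⋙ shiftFunctor (AcyclicHo R) n ⋙ cyclesFunctor R).Additive

instance (n : ℤ) : (shiftFunctor (StableCM R) n).Linear R := by
  have : (shiftFunctor (AcyclicHo R) n).Linear R :=
    have h1 : (acyclic R).ι.Linear R := ⟨fun _ _ => rfl⟩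
    have h2 : (shiftFunctor (AcyclicHo R) n ⋙ (acyclic R).ι).Linear R :=
      Functor.linear_of_iso R ((acyclic R).ι.commShiftIso n).symm
    ⟨fun f s => (acyclic R).ι.map_injective
      ((h2.map_smul f s).trans (h1.map_smul ((shiftFunctor (AcyclicHo R) n).map f) s).symm)⟩
  have : (cyclesFunctor R).inv.Linear R := by
    have : (cyclesFunctor R).asEquivalence.functor.Linear R :=
      inferInstanceAs ((cyclesFunctor R).Linear R)
    exact (cyclesFunctor R).asEquivalence.inverseLinear R
  exact inferInstanceAs
    (((cyclesFunctor R).inv ⋙ shiftFunctor (AcyclicHo R) n ⋙ cyclesFunctor R).Linear R)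

/-- The triangulation of the stable category of the Frobenius category `CM R`. For a morphism
`φ : K ⟶ L` of exact complexes of finitely generated free modules, `Z⁰` of the mapping cone of `φ` is
the pushout of the embedding `Z⁰ K ⟶ K⁰` along `Z⁰ φ : Z⁰ K ⟶ Z⁰ L`, with cokernel `Z¹ K`. So the
images of the mapping cone triangles are the standard triangles of the stable category, and a
triangle is distinguished if it is isomorphic to one of these. -/
noncomputable instance : Pretriangulated (StableCM R) where
  distinguishedTriangles :=
    {T | ∃ T' : Pretriangulated.Triangle (AcyclicHo R), T' ∈ Pretriangulated.distinguishedTriangles ∧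
      Nonempty (T ≅ (cyclesFunctor R).mapTriangle.obj T')}
  isomorphic_distinguished := by
    rintro T ⟨T', hT', ⟨e⟩⟩ T₂ e₂
    exact ⟨T', hT', ⟨e₂ ≪≫ e⟩⟩
  contractible_distinguished X := by
    obtain ⟨T', e, h⟩ := (cyclesFunctor R).contractible_mem_essImageDistTriang X
    exact ⟨T', h, ⟨e⟩⟩
  distinguished_cocone_triangle {X Y} f := by
    let a := (cyclesFunctor R).objObjPreimageIso X
    let b := (cyclesFunctor R).objObjPreimageIso Y
    obtain ⟨f', hf'⟩ := (cyclesFunctor R).map_surjective (a.hom ≫ f ≫ b.inv)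
    obtain ⟨Z, g, h, H⟩ := Pretriangulated.distinguished_cocone_triangle f'
    refine ⟨(cyclesFunctor R).obj Z, b.inv ≫ (cyclesFunctor R).map g,
      (cyclesFunctor R).map h ≫ ((cyclesFunctor R).commShiftIso (1 : ℤ)).hom.app _ ≫ a.hom⟦(1 : ℤ)⟧',
      _, H, ⟨Pretriangulated.Triangle.isoMk _ _ a.symm b.symm (Iso.refl _) ?_ ?_ ?_⟩⟩
    · change f ≫ b.inv = a.inv ≫ (cyclesFunctor R).map f'
      rw [hf', Iso.inv_hom_id_assoc]
    · exact Category.comp_id (b.inv ≫ (cyclesFunctor R).map g)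
    · have aux : ∀ {A B C D : StableCM R} (h : A ⟶ B) (c : B ⟶ C) (u : C ⟶ D) (v : D ⟶ C),
          u ≫ v = 𝟙 C → (h ≫ c ≫ u) ≫ v = 𝟙 A ≫ h ≫ c := by
        intro A B C D h c u v e
        rw [Category.assoc, Category.assoc, e, Category.comp_id, Category.id_comp]
      refine aux _ _ _ _ ?_
      exact ((shiftFunctor (StableCM R) (1 : ℤ)).mapIso a).hom_inv_id
  rotate_distinguished_triangle T := by
    have := (cyclesFunctor R).rotate_essImageDistTriang T
    constructor
    · rintro ⟨T', h, ⟨e⟩⟩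
      obtain ⟨T'', e', h'⟩ := this.1 ⟨T', e, h⟩
      exact ⟨T'', h', ⟨e'⟩⟩
    · rintro ⟨T', h, ⟨e⟩⟩
      obtain ⟨T'', e', h'⟩ := this.2 ⟨T', e, h⟩
      exact ⟨T'', h', ⟨e'⟩⟩
  complete_distinguished_triangle_morphism := by
    rintro T₁ T₂ ⟨T₁', h₁, ⟨e₁⟩⟩ ⟨T₂', h₂, ⟨e₂⟩⟩ a b fac
    refine (cyclesFunctor R).complete_distinguished_essImageDistTriang_morphism ?_ T₁ T₂
      ⟨T₁', e₁, h₁⟩ ⟨T₂', e₂, h₂⟩ a b fac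
    intro T₁' T₂' h₁ h₂ a b fac
    obtain ⟨a, rfl⟩ := (cyclesFunctor R).map_surjective a
    obtain ⟨b, rfl⟩ := (cyclesFunctor R).map_surjective b
    exact ⟨(cyclesFunctor R).mapTriangle.map
      (Pretriangulated.completeDistinguishedTriangleMorphism T₁' T₂' h₁ h₂ a b
        ((cyclesFunctor R).map_injective (by simpa using fac))), rfl, rfl⟩

instance : (cyclesFunctor R).IsTriangulated where
  map_distinguished T hT := ⟨T, hT, ⟨Iso.refl _⟩⟩

instance : IsTriangulated (StableCM R) :=
  have : ((cyclesFunctor R).mapComposableArrows 2).EssSurj :=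
    ⟨fun Y => ⟨Y ⋙ (cyclesFunctor R).inv,
      ⟨Functor.isoWhiskerLeft Y (cyclesFunctor R).asEquivalence.counitIso⟩⟩⟩
  isTriangulated_of_essSurj_mapComposableArrows_two (cyclesFunctor R)

end StableCM

/-- The objects of the stable category that are locally free on the punctured spectrum: `M_p` is a
free `R_p`-module for all prime ideals `p` other than the maximal ideal. -/
def CM₀ : ObjectProperty (StableCM R) := fun M =>
  ∀ (p : Ideal R) [p.IsPrime], p ≠ IsLocalRing.maximalIdeal R →
    Module.Free (Localization.AtPrime p) (LocalizedModule p.primeCompl M.module)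

variable {R}

lemma CM₀_iff (M : StableCM R) : CM₀ R M ↔ ∀ (p : Ideal R) [p.IsPrime],
    p ≠ IsLocalRing.maximalIdeal R → ∃ s : R, s ∉ p ∧ s • 𝟙 M = 0 := by
  have : Module.Finite R M.module := (CategoryTheory.Quotient.as M : CM R).property.1
  refine forall_congr' fun p => forall_congr' fun _ => forall_congr' fun _ => ?_
  simp only [StableCM.smul_id_eq_zero_iff]
  exact free_localization_iff p M.module

instance : (CM₀ R).IsClosedUnderIsomorphisms where
  of_iso {M N} e h := by
    rw [CM₀_iff] at h ⊢
    intro p hp hpm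
    obtain ⟨s, hs, h⟩ := h p hpm
    refine ⟨s, hs, ?_⟩
    rw [← e.inv_hom_id, ← Category.id_comp e.hom, ← Linear.comp_smul, ← Linear.smul_comp, h,
      zero_comp, comp_zero]

instance : (CM₀ R).IsTriangulated where
  exists_zero := ⟨0, isZero_zero _, by
    rw [CM₀_iff]
    intro p hp _
    exact ⟨1, (Ideal.ne_top_iff_one p).1 hp.ne_top, (isZero_zero _).eq_of_src _ _⟩⟩
  isStableUnderShiftBy n :=
    { le_shift := fun M h => by
        rw [CM₀_iff] at h
        rw [ObjectProperty.prop_shift_iff, CM₀_iff]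
        intro p hp hpm
        obtain ⟨s, hs, h⟩ := h p hpm
        refine ⟨s, hs, ?_⟩
        rw [← CategoryTheory.Functor.map_id, ← Functor.map_smul, h, Functor.map_zero] }
  toIsTriangulatedClosed₂ := .mk' fun T hT h₁ h₃ => by
    rw [CM₀_iff] at h₁ h₃ ⊢
    intro p hp hpm
    obtain ⟨s, hs, h₁⟩ := h₁ p hpm
    obtain ⟨t, ht, h₃⟩ := h₃ p hpm
    refine ⟨t * s, fun h => (hp.mem_or_mem h).elim ht hs, ?_⟩
    obtain ⟨g, hg⟩ := Pretriangulated.Triangle.coyoneda_exact₂ T hT (t • 𝟙 T.obj₂) (by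
      rw [Linear.smul_comp, Category.id_comp, ← Category.comp_id T.mor₂, ← Linear.comp_smul, h₃,
        comp_zero])
    rw [mul_comm, mul_smul, hg, ← Linear.comp_smul, ← Category.id_comp T.mor₁, ← Linear.smul_comp,
      h₁, zero_comp, comp_zero]

variable (R) in
/-- The Verdier quotient of the stable category by the triangulated subcategory `CM₀ R`, that is, its
localization at the morphisms whose cone is in `CM₀ R`. The full subcategory
`(CM₀ R).FullSubcategory` and this quotient carry the induced shifts and triangulations. -/
abbrev VerdierQuotient : Type (u + 1) := (CM₀ R).trW.Localization


end Triangulated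

end StableMCM

open StableMCM

/-! The definition of `CM₀` refers to the base ring, whereas `F` is not linear over anything. The
point is to recognise the objects of `CM₀` from the abstract ring `End M` alone.

By `CM₀_iff`, an object `M` lies in `CM₀ R` if and only if every prime `p` other than the maximal
ideal misses some `s` in `R` with `s • 𝟙 M = 0`. This concerns only the `R`-algebra `E = End M`,
which is a finite `R`-module. Let `J` be the kernel of `R → E`. The condition says that no prime
except possibly the maximal ideal contains `J`. Then `R ⧸ J` is artinian, and so is the finite
algebra `E`. Conversely, if `E` is left artinian and `x` is in the maximal ideal, the chain of left
ideals `E xⁿ` stabilizes, and Nakayama's lemma gives `xⁿ E = 0` for some `n`; an `x` outside `p`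
then provides `s = xⁿ`. This is `forall_prime_iff_isArtinianRing`. The condition does not change
when `E` is replaced by its opposite, so left and right artinian are equivalent here.

An equivalence of additive categories preserves endomorphism rings, hence preserves and reflects
`CM₀` (`CM₀_obj_iff`). The statements on the subcategories and on the Verdier quotients are then
formal: `CM₀ R` is the inverse image of `CM₀ S`, and the morphisms with cone in `CM₀ R` are the
inverse image of those with cone in `CM₀ S`. -/

/-! ### Artinian module-finite algebras over a noetherian local ring -/

/-- A module-finite algebra over a commutative noetherian ring `R` in which every non-maximal prime
of the local ring `R` has an element outside it that kills the algebra is left artinian. -/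
lemma isArtinianRing_of_forall_prime {R : Type*} [CommRing R] [IsLocalRing R] [IsNoetherianRing R]
    {E : Type*} [Ring E] [Algebra R E] [Module.Finite R E]
    (h : ∀ (p : Ideal R) [p.IsPrime], p ≠ IsLocalRing.maximalIdeal R →
      ∃ s : R, s ∉ p ∧ s • (1 : E) = 0) : IsArtinianRing E := by
  let J : Ideal R := RingHom.ker (algebraMap R E)
  have hJ : IsArtinianRing (R ⧸ J) := by
    refine (isArtinianRing_iff_isNoetherianRing_krullDimLE_zero).2 ⟨inferInstance, ?_⟩
    refine Ring.krullDimLE_zero_iff.2 fun q hq => ?_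
    -- The preimage of `q` contains `J`. An `s` that kills `1` lies in `J`, so it cannot lie outside
    -- this preimage.
    have hp : q.comap (Ideal.Quotient.mk J) = IsLocalRing.maximalIdeal R := by
      by_contra hp
      obtain ⟨s, hs, hs0⟩ := h _ hp
      refine hs (Ideal.mem_comap.2 ?_)
      rw [Ideal.Quotient.eq_zero_iff_mem.2
        ((Algebra.algebraMap_eq_smul_one s).trans hs0 : algebraMap R E s = 0)]
      exact q.zero_mem
    have : (q.comap (Ideal.Quotient.mk J)).IsMaximal := hp ▸ inferInstance
    rw [← Ideal.map_comap_of_surjective _ Ideal.Quotient.mk_surjective q]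
    refine (Ideal.map_eq_top_or_isMaximal_of_surjective _ Ideal.Quotient.mk_surjective
      this).resolve_left ?_
    rw [Ideal.map_comap_of_surjective _ Ideal.Quotient.mk_surjective q]
    exact hq.ne_top
  let : Module (R ⧸ J) E := Module.IsTorsionBySet.module (R := R) (I := J) (by
    rintro x ⟨a, ha⟩
    change a • x = 0
    rw [Algebra.smul_def, RingHom.mem_ker.1 ha, zero_mul])
  have tower : IsScalarTower R (R ⧸ J) E := Module.IsTorsionBySet.isScalarTower _
  -- This makes left ideals of `E` into `R ⧸ J`-submodules, so that the descending chain condition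
  -- passes from `R ⧸ J`-submodules to left ideals.
  have : IsScalarTower (R ⧸ J) E E := ⟨fun a x y => by
    obtain ⟨a, rfl⟩ := Ideal.Quotient.mk_surjective a
    exact smul_mul_assoc a x y⟩
  have : Module.Finite (R ⧸ J) E := Module.Finite.of_restrictScalars_finite R _ _
  have : IsArtinian (R ⧸ J) E := inferInstance
  exact isArtinian_of_tower (R ⧸ J) this

/-- If a module-finite algebra over a local ring is left artinian, then some power of each nonunit of
the base kills it. -/
lemma exists_pow_smul_one_eq_zero {R : Type*} [CommRing R] [IsLocalRing R]
    {E : Type*} [Ring E] [Algebra R E] [Module.Finite R E] [IsArtinianRing E] {x : R}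
    (hx : x ∈ IsLocalRing.maximalIdeal R) : ∃ n : ℕ, x ^ n • (1 : E) = 0 := by
  -- The descending chain of left ideals `E xⁿ`; the order dual turns it into a monotone map.
  let f : ℕ →o (Submodule E E)ᵒᵈ :=
    { toFun := fun n => Submodule.span E {x ^ n • (1 : E)}
      monotone' := monotone_nat_of_le_succ fun n => by
        change Submodule.span E _ ≤ Submodule.span E _
        rw [Submodule.span_singleton_le_iff_mem, Submodule.mem_span_singleton]
        exact ⟨x • 1, by rw [smul_eq_mul, smul_mul_smul_comm, mul_one, ← pow_succ']⟩ }
  obtain ⟨n, hn⟩ := IsArtinian.monotone_stabilizes f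
  refine ⟨n, ?_⟩
  have h1 : x ^ n • (1 : E) ∈ Submodule.span E {x ^ (n + 1) • (1 : E)} := by
    have : Submodule.span E {x ^ n • (1 : E)} = Submodule.span E {x ^ (n + 1) • (1 : E)} :=
      hn (n + 1) n.le_succ
    rw [← this]
    exact Submodule.mem_span_singleton_self _
  -- Stabilization gives `xⁿ = e xⁿ⁺¹` in `E`; since scalars are central, `he` becomes `xⁿ⁺¹ • e =
  -- xⁿ • 1`.
  obtain ⟨e, he⟩ := Submodule.mem_span_singleton.1 h1
  rw [smul_eq_mul, mul_smul_comm, mul_one] at he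
  have hfg : (LinearMap.range (x ^ n • (LinearMap.id : E →ₗ[R] E))).FG := by
    rw [LinearMap.range_eq_map]
    exact Module.Finite.fg_top.map _
  let N : Submodule R E := LinearMap.range (x ^ n • (LinearMap.id : E →ₗ[R] E))
  -- Nakayama's lemma for `N = xⁿ E`: the relation `he` gives `xⁿ y = x (xⁿ (e y))`, so `N` is
  -- contained in the maximal ideal times `N`.
  have hN : N = ⊥ := by
    refine Submodule.eq_bot_of_le_smul_of_le_jacobson_bot (IsLocalRing.maximalIdeal R) N
      hfg ?_
      (IsLocalRing.maximalIdeal_le_jacobson _)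
    rintro _ ⟨y, rfl⟩
    have : (x ^ n • (LinearMap.id : E →ₗ[R] E)) y = x • (x ^ n • (e * y)) := by
      change x ^ n • y = _
      rw [smul_smul, ← pow_succ', ← smul_mul_assoc, he, smul_mul_assoc, one_mul]
    rw [this]
    exact Submodule.smul_mem_smul hx ⟨e * y, rfl⟩
  rw [← Submodule.mem_bot R, ← hN]
  exact ⟨1, rfl⟩

/-- The right-hand side no longer mentions `R`, which is what allows a comparison across a
non-linear functor. For the converse direction, a prime `p` other than the maximal ideal is strictly
contained in it; an `x` in the difference has all its powers outside `p`, and one of them kills `E`.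
-/
lemma forall_prime_iff_isArtinianRing (R : Type*) [CommRing R] [IsLocalRing R] [IsNoetherianRing R]
    (E : Type*) [Ring E] [Algebra R E] [Module.Finite R E] :
    (∀ (p : Ideal R) [p.IsPrime], p ≠ IsLocalRing.maximalIdeal R →
      ∃ s : R, s ∉ p ∧ s • (1 : E) = 0) ↔ IsArtinianRing E := by
  refine ⟨isArtinianRing_of_forall_prime, fun _ p hp hpm => ?_⟩
  obtain ⟨x, hx, hxp⟩ := SetLike.exists_of_lt
    (lt_of_le_of_ne (IsLocalRing.le_maximalIdeal hp.ne_top) hpm)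
  obtain ⟨n, hn⟩ := exists_pow_smul_one_eq_zero (E := E) hx
  exact ⟨x ^ n, fun h => hxp (hp.mem_of_pow_mem n h), hn⟩

namespace StableMCM

/-! ### Local freeness read off the stable endomorphism ring -/

section

variable {R : Type u} [CommRing R] [IsGorensteinLocalRing R]

/-- The stable endomorphism ring is a quotient of the module of all endomorphisms, which is finite
because the underlying module is finitely generated over a noetherian ring. -/
instance (M : StableCM R) : Module.Finite R (End M) := by
  let N : CM R := CategoryTheory.Quotient.as M
  have : Module.Finite R N.obj := N.property.1
  let f : (N.obj →ₗ[R] N.obj) →ₗ[R] (N ⟶ N) :=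
    { toFun := fun φ => (isMCM R).homMk (ModuleCat.ofHom φ)
      map_add' := fun _ _ => rfl
      map_smul' := fun _ _ => rfl }
  refine Module.Finite.of_surjective ((StableCM.quotient R).mapLinearMap R ∘ₗ f) fun e => ?_
  obtain ⟨φ, rfl⟩ := (StableCM.quotient R).map_surjective (X := N) (Y := N) e
  exact ⟨φ.hom.hom, rfl⟩

/-- An object is locally free on the punctured spectrum if and only if its stable endomorphism ring
is left artinian. -/
lemma CM₀_iff_isArtinianRing (M : StableCM R) : CM₀ R M ↔ IsArtinianRing (End M) :=
  (CM₀_iff M).trans (forall_prime_iff_isArtinianRing R (End M))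

/-- An object is locally free on the punctured spectrum if and only if its stable endomorphism ring
is right artinian. -/
lemma CM₀_iff_isArtinianRing_op (M : StableCM R) : CM₀ R M ↔ IsArtinianRing (End M)ᵐᵒᵖ := by
  have : Module.Finite R (End M)ᵐᵒᵖ :=
    Module.Finite.equiv (MulOpposite.opLinearEquiv R : End M ≃ₗ[R] (End M)ᵐᵒᵖ)
  rw [← forall_prime_iff_isArtinianRing R, CM₀_iff]
  refine forall_congr' fun p => forall_congr' fun _ => forall_congr' fun _ =>
    exists_congr fun s => and_congr_right fun _ => ?_
  -- The unit and the scalar action are the same in a ring and in its opposite, so the condition `s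
  -- • 1 = 0` is too.
  rw [← MulOpposite.op_one, ← MulOpposite.op_smul, MulOpposite.op_eq_zero_iff]
  rfl

end

/-! ### Transport along a triangle equivalence -/

section

variable {R : Type u} {S : Type v} [CommRing R] [CommRing S]
  [IsGorensteinLocalRing R] [IsGorensteinLocalRing S]
  (F : StableCM R ⥤ StableCM S) [F.CommShift ℤ] [F.IsTriangulated] [F.IsEquivalence]

/-- A fully faithful additive functor induces a ring isomorphism from `End M` to `End (F.obj M)`,
and being artinian depends on the ring alone. No compatibility with the actions of `R` and `S` is
needed. -/
lemma CM₀_obj_iff (M : StableCM R) : CM₀ R M ↔ CM₀ S (F.obj M) := by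
  let e : End M ≃+* End (F.obj M) :=
    { (Functor.FullyFaithful.ofFullyFaithful F).mulEquivEnd M with
      map_add' := fun _ _ => F.map_add }
  rw [CM₀_iff_isArtinianRing, CM₀_iff_isArtinianRing]
  exact ⟨fun _ => e.isArtinianRing, fun _ => e.symm.isArtinianRing⟩

/-- As an equality, `CM₀_obj_iff` can be rewritten inside `trW`, the class of morphisms with cone in
the subcategory. -/
lemma inverseImage_CM₀ : (CM₀ S).inverseImage F = CM₀ R := by
  ext M
  exact (CM₀_obj_iff F M).symm

/-- Full faithfulness is inherited from `F` and the inclusions. Only essential surjectivity needs an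
argument: a preimage under `F` of an object of `CM₀ S` lies in `CM₀ R`, because `F` reflects the
property. -/
lemma exists_restriction : ∃ (F₀ : (CM₀ R).FullSubcategory ⥤ (CM₀ S).FullSubcategory)
    (_ : F₀.CommShift ℤ), F₀.IsTriangulated ∧ F₀.IsEquivalence ∧
      ∃ e : F₀ ⋙ (CM₀ S).ι ≅ (CM₀ R).ι ⋙ F, NatTrans.CommShift e.hom ℤ := by
  have hF : ∀ X : (CM₀ R).FullSubcategory, CM₀ S (((CM₀ R).ι ⋙ F).obj X) :=
    fun X => (CM₀_obj_iff F X.obj).1 X.property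
  refine ⟨(CM₀ S).lift ((CM₀ R).ι ⋙ F) hF, inferInstance, inferInstance, ?_,
    (CM₀ S).liftCompιIso _ hF, inferInstance⟩
  have : ((CM₀ S).lift ((CM₀ R).ι ⋙ F) hF).EssSurj := ⟨fun Y => by
    let X := F.objPreimage Y.obj
    have e : F.obj X ≅ Y.obj := F.objObjPreimageIso Y.obj
    exact ⟨⟨X, (CM₀_obj_iff F X).2 ((CM₀ S).prop_of_iso e.symm Y.property)⟩,
      ⟨(CM₀ S).isoMk e⟩⟩⟩
  exact { }

/-- A triangle equivalence, as a morphism between the localizers of the Verdier quotients. -/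
abbrev verdierLocalizerMorphism : LocalizerMorphism (CM₀ R).trW (CM₀ S).trW where
  functor := F
  map _ _ f hf := by
    rw [← inverseImage_CM₀ F] at hf
    exact (ObjectProperty.inverseImage_trW_iff _ F f).1 hf

/-- Since `F` preserves cones, a morphism has its cone in `CM₀ R` exactly when its image has its
cone in `CM₀ S`. An equivalence that matches the two classes in this way induces an equivalence of
localizations. -/
instance : (verdierLocalizerMorphism F).IsInduced where
  inverseImage_eq := by
    ext X Y f
    have := ObjectProperty.inverseImage_trW_iff (CM₀ S) F f
    rw [inverseImage_CM₀] at this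
    exact this.symm

lemma exists_verdierQuotient_equivalence : ∃ (G : VerdierQuotient R ⥤ VerdierQuotient S)
    (_ : G.CommShift ℤ), G.IsTriangulated ∧ G.IsEquivalence ∧
      ∃ e : (CM₀ R).trW.Q ⋙ G ≅ F ⋙ (CM₀ S).trW.Q, NatTrans.CommShift e.hom ℤ := by
  let Φ := verdierLocalizerMorphism F
  let G := Φ.localizedFunctor (CM₀ R).trW.Q (CM₀ S).trW.Q
  let e₀ : F ⋙ (CM₀ S).trW.Q ≅ (CM₀ R).trW.Q ⋙ G :=
    (Φ.catCommSq (CM₀ R).trW.Q (CM₀ S).trW.Q).iso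
  -- The compatibility of `G` with the shifts is the one induced through `e₀` from that of `F`, so
  -- `e₀` respects the shifts.
  let : G.CommShift ℤ := Φ.commShift ℤ _ _ G e₀
  have he₀ : NatTrans.CommShift e₀.hom ℤ := Φ.natTransCommShift_hom _ _ G e₀
  have : NatTrans.CommShift e₀.symm.hom ℤ := inferInstanceAs (NatTrans.CommShift e₀.inv ℤ)
  have := Φ.isLocalizedEquivalence_of_isInduced
  have : G.IsEquivalence := Φ.localizedFunctor_isEquivalence _ _
  -- Every morphism of the quotient is isomorphic to the image of a morphism of the stable category,
  -- so every distinguished triangle is isomorphic to the image of one. Hence `G` is triangulated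
  -- because its composite with the quotient functor is.
  have := Localization.essSurj_mapArrow (CM₀ R).trW.Q (CM₀ R).trW
  exact ⟨G, inferInstance, Functor.isTriangulated_of_precomp_iso e₀.symm,
    inferInstance, e₀.symm, inferInstance⟩

end

end StableMCM

theorem mainTheorem10 (R : Type u) (S : Type v) [CommRing R] [CommRing S]
    [IsGorensteinLocalRing R] [IsGorensteinLocalRing S]
    (F : StableCM R ⥤ StableCM S) [F.CommShift ℤ] [F.IsTriangulated] [F.IsEquivalence] :
    (∀ M : StableCM R, (CM₀ R M ↔ IsArtinianRing (End M)) ∧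
      (CM₀ R M ↔ IsArtinianRing (End M)ᵐᵒᵖ)) ∧
    (∀ M : StableCM S, (CM₀ S M ↔ IsArtinianRing (End M)) ∧
      (CM₀ S M ↔ IsArtinianRing (End M)ᵐᵒᵖ)) ∧
    (∀ M : StableCM R, CM₀ R M ↔ CM₀ S (F.obj M)) ∧
    (∃ (F₀ : (CM₀ R).FullSubcategory ⥤ (CM₀ S).FullSubcategory) (_ : F₀.CommShift ℤ),
      F₀.IsTriangulated ∧ F₀.IsEquivalence ∧
      ∃ e : F₀ ⋙ (CM₀ S).ι ≅ (CM₀ R).ι ⋙ F, NatTrans.CommShift e.hom ℤ) ∧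
    (∃ (G : VerdierQuotient R ⥤ VerdierQuotient S) (_ : G.CommShift ℤ),
      G.IsTriangulated ∧ G.IsEquivalence ∧
      ∃ e : (CM₀ R).trW.Q ⋙ G ≅ F ⋙ (CM₀ S).trW.Q, NatTrans.CommShift e.hom ℤ) :=
  ⟨fun M => ⟨CM₀_iff_isArtinianRing M, CM₀_iff_isArtinianRing_op M⟩,
    fun M => ⟨CM₀_iff_isArtinianRing M, CM₀_iff_isArtinianRing_op M⟩,
    CM₀_obj_iff F, exists_restriction F, exists_verdierQuotient_equivalence F⟩
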